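/- Let $G$ be a stochastic arena: a finite directed graph $(V,E)$ in which every vertex has a successor, with $V$ partitioned into $V_\exists$ (Eve), $V_\forall$ (Adam) and $V_R$ (random), and a function $\Delta\colon V\times V\to[0,1]$ such that for $u\in V_R$, $\Delta(u,\cdot)$ is a probability distribution with support $\{w : (u,w)\in E\}$, while for $u\in V_\exists\cup V_\forall$, $\Delta(u,w)=1$ if $(u,w)\in E$ and $\Delta(u,w)=0$ otherwise. Let $p\colon V\to\mathbb N$ be a priority function and $\alpha\colon\mathbb N\to[0,1]$, $i\mapsto\alpha_i$, a non-increasing function. The arena $\widetilde G$ has the vertices $\overline v,\widehat v$ for $v\in V$ and two sinks $v_{\mathrm{win}},v_{\mathrm{lose}}$. Its transition function is $\widetilde\Delta(\overline u,\widehat w)=\Delta(u,w)$, $\widetilde\Delta(\widehat u,\overline u)=1-\alpha_{p(u)}$, $\widetilde\Delta(\widehat u,v_{\mathrm{win}})=\alpha_{p(u)}$ if $p(u)$ is even, $\widetilde\Delta(\widehat u,v_{\mathrm{lose}})=\alpha_{p(u)}$ if $p(u)$ is odd, $\widetilde\Delta(v_{\mathrm{win}},v_{\mathrm{win}})=\widetilde\Delta(v_{\mathrm{lose}},v_{\mathrm{lose}})=1$,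 and $0$ otherwise; its edges are the pairs where $\widetilde\Delta>0$. The vertex $\overline v$ belongs to the same player as $v$ (or is random if $v$ is), and all other vertices are random. A pure memoryless strategy of a player assigns to each of his or her vertices one of its successors. A pair $(\sigma,\gamma)$ of pure memoryless strategies of Eve and Adam in $G$ is also used in $\widetilde G$ (a move $u\mapsto w$ becomes $\overline u\mapsto\widehat w$), and turns $G$ and $\widetilde G$ into finite Markov chains $G_{\sigma,\gamma}$ and $\widetilde G_{\sigma,\gamma}$. A pBSCC of $\widetilde G_{\sigma,\gamma}$ is a set $\widetilde U=\{\overline u,\widehat u : u\in U\}$ where $U$ is a bottom strongly connected component of $G_{\sigma,\gamma}$. Let $n=|V|$, $\delta_{\min}=\min\{\Delta(u,w) : u,w\in V,\ \Delta(u,w)>0\}$, $x_0=\delta_{\min}(1-\alpha_0)$ and $x_1=(1-\delta_{\min})(1-\alpha_0)$. Then for every pair $(\sigma,\gamma)$ of pure memoryless strategies and every $v\in V$, the probability that a play of $\widetilde G_{\sigma,\gamma}$ starting in $\overline v$ reaches a pBSCC is at least $$\frac{(1-x_0)\,x_0^{\,n}}{(1-x_0)-(1-x_0^{\,n})\,x_1}.$$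 (In the degenerate case $\alpha_0=0$, $\delta_{\min}=1$, the only one in which the denominator vanishes, the quotient $0/0$ is read as $0$.) -/

import Mathlib

open scoped ENNReal

noncomputable section

/-! ### Finite Markov chains -/

/-- A discrete-time Markov chain on the finite state space `S` (without initial state). -/
structure FinMarkovChain (S : Type*) [Fintype S] where
  /-- Transition probabilities. -/
  prob : S → S → ℝ
  prob_nonneg : ∀ u v, 0 ≤ prob u v
  prob_sum : ∀ u, ∑ v, prob u v = 1

namespace FinMarkovChain

variable {S : Type*} [Fintype S]

/-- The probability of the finite path `π 0, π 1, …, π m`. -/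
def pathProb (M : FinMarkovChain S) {m : ℕ} (π : Fin (m + 1) → S) : ℝ :=
  ∏ i : Fin m, M.prob (π i.castSucc) (π i.succ)

/-- The finite sequence `π 0, …, π m` starts in `v`, ends in `T`, and visits `T` only at its
end. -/
def IsFirstHit (v : S) (T : Set S) {m : ℕ} (π : Fin (m + 1) → S) : Prop :=
  π 0 = v ∧ (∀ i : Fin m, π i.castSucc ∉ T) ∧ π (Fin.last m) ∈ T

open Classical in
/-- The probability of reaching `T` from `v`: the total probability of the finite paths from `v`
that lie in `(S \ T)* T`. (Sequences that use a transition of probability `0` contribute `0`.) -/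
def reachProb (M : FinMarkovChain S) (v : S) (T : Set S) : ℝ≥0∞ :=
  ∑' m : ℕ, ∑ π : Fin (m + 1) → S,
    if IsFirstHit v T π then ENNReal.ofReal (M.pathProb π) else 0

/-- `v` is reachable from `u` by a path with at least one transition. -/
def Reachable (M : FinMarkovChain S) : S → S → Prop :=
  Relation.TransGen fun u v => 0 < M.prob u v

/-- A nonempty set of pairwise mutually reachable states. -/
def IsStronglyConnected (M : FinMarkovChain S) (L : Set S) : Prop :=
  L.Nonempty ∧ ∀ u ∈ L, ∀ v ∈ L, M.Reachable u v

/-- A strongly connected component: a maximal strongly connected set. -/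
def IsSCC (M : FinMarkovChain S) (L : Set S) : Prop :=
  Maximal M.IsStronglyConnected L

/-- A bottom strongly connected component: an SCC that no transition leaves. -/
def IsBSCC (M : FinMarkovChain S) (L : Set S) : Prop :=
  M.IsSCC L ∧ ∀ u ∈ L, ∀ v ∉ L, ¬ 0 < M.prob u v

end FinMarkovChain

/-! ### Stochastic arenas and pure memoryless strategies -/

/-- The three classes into which the vertices of a stochastic arena are partitioned. -/
inductive VertexKind where
  | eve
  | adam
  | random

/-- A (non-blocking) stochastic arena on the finite vertex set `V`. The function `Δ` is a
distribution with support the set of successors on each random vertex, and it has the value `1` on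
each edge that leaves a vertex of Eve or Adam, as such an edge is taken surely once chosen. -/
structure StochasticArena (V : Type*) [Fintype V] where
  kind : V → VertexKind
  E : V → V → Prop
  Δ : V → V → ℝ
  Δ_nonneg : ∀ u v, 0 ≤ Δ u v
  Δ_sum : ∀ u, kind u = .random → ∑ v, Δ u v = 1
  edge_iff : ∀ u v, E u v ↔ 0 < Δ u v
  Δ_player : ∀ u v, kind u ≠ .random → E u v → Δ u v = 1
  nonblocking : ∀ u, ∃ v, E u v

namespace StochasticArena

variable {V : Type*} [Fintype V]

/-- Pure memoryless strategies of Eve. -/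
structure EveStrategy (G : StochasticArena V) where
  move : ∀ u, G.kind u = .eve → V
  move_edge : ∀ u h, G.E u (move u h)

/-- Pure memoryless strategies of Adam. -/
structure AdamStrategy (G : StochasticArena V) where
  move : ∀ u, G.kind u = .adam → V
  move_edge : ∀ u h, G.E u (move u h)

/-- Under `σ` and `γ` the transition from `u` to `v` is enabled: `u` is random, or `v` is the
successor of `u` chosen by the owner of `u`. -/
def Enabled (G : StochasticArena V) (σ : G.EveStrategy) (γ : G.AdamStrategy) (u v : V) : Prop :=
  G.kind u = .random ∨ (∃ h : G.kind u = .eve, σ.move u h = v) ∨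
    ∃ h : G.kind u = .adam, γ.move u h = v

open Classical in
/-- The Markov chain given by the sub-arena that results from fixing `σ` and `γ`. -/
def chain (G : StochasticArena V) (σ : G.EveStrategy) (γ : G.AdamStrategy) :
    FinMarkovChain V where
  prob u v := if G.Enabled σ γ u v then G.Δ u v else 0
  prob_nonneg u v := by
    split_ifs
    · exact G.Δ_nonneg u v
    · exact le_rfl
  prob_sum u := by
    have key : ∀ w : V, G.E u w → G.kind u ≠ .random →
        (∀ v, G.Enabled σ γ u v ↔ w = v) →
        (∑ v, if G.Enabled σ γ u v then G.Δ u v else 0) = 1 := by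
      intro w hw hk hv
      simp [hv, G.Δ_player u w hk hw]
    rcases hk : G.kind u with _ | _ | _
    · exact key (σ.move u hk) (σ.move_edge u hk) (by simp [hk]) (by simp [Enabled, hk])
    · exact key (γ.move u hk) (γ.move_edge u hk) (by simp [hk]) (by simp [Enabled, hk])
    · simpa [Enabled, hk] using G.Δ_sum u hk

/-- The least positive value of `Δ`. -/
def minProb (G : StochasticArena V) : ℝ :=
  sInf {x : ℝ | 0 < x ∧ ∃ u v, G.Δ u v = x}

/-- On a nonempty vertex set the minimum is attained. -/
theorem isLeast_minProb [Nonempty V] (G : StochasticArena V) :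
    IsLeast {x : ℝ | 0 < x ∧ ∃ u v, G.Δ u v = x} G.minProb := by
  have hfin : {x : ℝ | 0 < x ∧ ∃ u v, G.Δ u v = x}.Finite := by
    refine (Set.finite_range fun q : V × V => G.Δ q.1 q.2).subset ?_
    rintro x ⟨-, u, v, rfl⟩
    exact ⟨(u, v), rfl⟩
  have hne : {x : ℝ | 0 < x ∧ ∃ u v, G.Δ u v = x}.Nonempty := by
    obtain ⟨u⟩ := ‹Nonempty V›
    obtain ⟨v, hv⟩ := G.nonblocking u
    exact ⟨_, (G.edge_iff u v).1 hv, u, v, rfl⟩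
  exact ⟨hne.csInf_mem hfin, fun x hx => csInf_le hfin.bddBelow hx⟩

end StochasticArena

/-! ### The gadget construction -/

/-- The vertices of the transformed arena: two copies `bar v` and `hat v` of each vertex `v`, and
the winning and losing sinks. -/
inductive GadgetVertex (V : Type*) where
  | bar (v : V)
  | hat (v : V)
  | win
  | lose

namespace GadgetVertex

/-- The vertex set of the transformed arena as a disjoint union. -/
def equivSum (V : Type*) : V ⊕ V ⊕ Bool ≃ GadgetVertex V where
  toFun
    | .inl v => bar v
    | .inr (.inl v) => hat v
    | .inr (.inr true) => win
    | .inr (.inr false) => lose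
  invFun
    | bar v => .inl v
    | hat v => .inr (.inl v)
    | win => .inr (.inr true)
    | lose => .inr (.inr false)
  left_inv := by rintro (v | v | _ | _) <;> rfl
  right_inv := by rintro (v | v | _ | _) <;> rfl

instance {V : Type*} [Fintype V] : Fintype (GadgetVertex V) :=
  Fintype.ofEquiv _ (equivSum V)

theorem sum_eq {V : Type*} [Fintype V] (f : GadgetVertex V → ℝ) :
    ∑ x, f x = ∑ v, f (bar v) + ∑ v, f (hat v) + f win + f lose := by
  rw [← (equivSum V).sum_comp f]
  simp [equivSum, Fintype.sum_sum_type, add_assoc]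

/-- The set of both copies of the vertices in `U`. -/
def tilde {V : Type*} (U : Set V) : Set (GadgetVertex V) :=
  bar '' U ∪ hat '' U

end GadgetVertex

namespace StochasticArena

open GadgetVertex

variable {V : Type*} [Fintype V]

open Classical in
/-- The transition function of the transformed arena: `α i` is the probability of entering a sink
before visiting a vertex of priority `i`. -/
def gadgetΔ (G : StochasticArena V) (p : V → ℕ) (α : ℕ → unitInterval) :
    GadgetVertex V → GadgetVertex V → ℝ
  | bar u, hat w => G.Δ u w
  | hat u, bar w => if u = w then 1 - (α (p u) : ℝ) else 0
  | hat u, win => if Even (p u) then (α (p u) : ℝ) else 0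
  | hat u, lose => if Odd (p u) then (α (p u) : ℝ) else 0
  | win, win => 1
  | lose, lose => 1
  | _, _ => 0

/-- Owners in the transformed arena: `bar v` is owned as `v` is, all other vertices are random. -/
def gadgetKind (G : StochasticArena V) : GadgetVertex V → VertexKind
  | bar v => G.kind v
  | _ => .random

open Classical in
/-- The arena obtained by sending each transition into `v` through `hat v`, which moves on to
`bar v` or, with probability `α (p v)`, to the winning (`p v` even) or losing (`p v` odd) sink.
Its edges are the transitions of positive probability. When `0 < α (p v) < 1` for all `v` they are
the pairs `(bar u, hat v)` with `(u, v)` an edge, `(hat v, bar v)`, `(hat v, win)` for `p v` even,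
`(hat v, lose)` for `p v` odd, `(win, win)` and `(lose, lose)`. -/
def gadget (G : StochasticArena V) (p : V → ℕ) (α : ℕ → unitInterval) :
    StochasticArena (GadgetVertex V) where
  kind := G.gadgetKind
  E x y := 0 < G.gadgetΔ p α x y
  Δ := G.gadgetΔ p α
  Δ_nonneg x y := by
    have h0 := fun i => (α i).2.1
    have h1 := fun i => (α i).2.2
    rcases x with u | u | _ | _ <;> rcases y with w | w | _ | _ <;>
      simp only [gadgetΔ, le_refl, zero_le_one, G.Δ_nonneg] <;> split_ifs <;>
      simp [h0, h1]
  Δ_sum x hx := by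
    rcases x with u | u | _ | _
    · simpa [sum_eq, gadgetΔ] using G.Δ_sum u hx
    · rcases Nat.even_or_odd (p u) with h | h
      · simp [sum_eq, gadgetΔ, h, Nat.not_odd_iff_even.2 h]
      · simp [sum_eq, gadgetΔ, h, Nat.not_even_iff_odd.2 h]
    · simp [sum_eq, gadgetΔ]
    · simp [sum_eq, gadgetΔ]
  edge_iff _ _ := Iff.rfl
  Δ_player x y hx hxy := by
    rcases x with u | u | _ | _
    · rcases y with w | w | _ | _
      · simp [gadgetΔ] at hxy
      · exact G.Δ_player u w hx ((G.edge_iff u w).2 hxy)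
      · simp [gadgetΔ] at hxy
      · simp [gadgetΔ] at hxy
    all_goals exact absurd rfl hx
  nonblocking x := by
    rcases x with u | u | _ | _
    · obtain ⟨v, hv⟩ := G.nonblocking u
      exact ⟨hat v, (G.edge_iff u v).1 hv⟩
    · rcases (α (p u)).2.2.lt_or_eq with h | h
      · exact ⟨bar u, by simpa [gadgetΔ] using h⟩
      · rcases Nat.even_or_odd (p u) with h' | h'
        · exact ⟨win, by simp [gadgetΔ, h', h]⟩
        · exact ⟨lose, by simp [gadgetΔ, h', h]⟩
    · exact ⟨win, by simp [gadgetΔ]⟩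
    · exact ⟨lose, by simp [gadgetΔ]⟩

/-- A strategy of Eve, used in the transformed arena. -/
def EveStrategy.lift {G : StochasticArena V} (σ : G.EveStrategy) (p : V → ℕ)
    (α : ℕ → unitInterval) : (G.gadget p α).EveStrategy where
  move
    | bar u, h => hat (σ.move u h)
  move_edge x h := by
    rcases x with u | u | _ | _
    · exact (G.edge_iff _ _).1 (σ.move_edge u h)
    all_goals exact nomatch (h : VertexKind.random = VertexKind.eve)

/-- A strategy of Adam, used in the transformed arena. -/
def AdamStrategy.lift {G : StochasticArena V} (γ : G.AdamStrategy) (p : V → ℕ)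
    (α : ℕ → unitInterval) : (G.gadget p α).AdamStrategy where
  move
    | bar u, h => hat (γ.move u h)
  move_edge x h := by
    rcases x with u | u | _ | _
    · exact (G.edge_iff _ _).1 (γ.move_edge u h)
    all_goals exact nomatch (h : VertexKind.random = VertexKind.adam)

/-- `P` is a pBSCC: the set of both copies of the vertices of a BSCC of the original arena under
`σ` and `γ`. -/
def IsPBSCC (G : StochasticArena V) (σ : G.EveStrategy) (γ : G.AdamStrategy)
    (P : Set (GadgetVertex V)) : Prop :=
  ∃ U : Set V, (G.chain σ γ).IsBSCC U ∧ P = tilde U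

/-- The probability that a play of the transformed arena under `σ` and `γ` that starts in `bar v`
reaches a pBSCC. -/
def crossPathProb (G : StochasticArena V) (p : V → ℕ) (α : ℕ → unitInterval)
    (σ : G.EveStrategy) (γ : G.AdamStrategy) (v : V) : ℝ≥0∞ :=
  ((G.gadget p α).chain (σ.lift p α) (γ.lift p α)).reachProb (bar v)
    (⋃₀ {P | G.IsPBSCC σ γ P})

end StochasticArena

end

/-! Let `q v` be the probability of reaching a pBSCC from `bar v`, and put `δ = minProb`, `c = 1 - α
0`. A round `bar v → hat w → bar w` survives the gadget with probability `1 - α (p w) ≥ c`, because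
`α` is non-increasing. So `q` is 1 on the bottom components of the original chain, and elsewhere it
is at least `c` times its average over the successors (`discounted_average_le_crossPathProb`).

The rest concerns the original chain only (`geometric_bound_le`). Let `u` minimise `q`. A state
outside the bottom components with a successor `w` one layer closer to them satisfies `q ≥ x₀ * q w
+ x₁ * q u`: weight at least `δ` goes to `w`, and the rest is worth at least `q u`. Every state is
within `n` steps of a bottom component, so iterating gives `q u ≥ x₀ ^ n + x₁ * q u * (1 + x₀ + ⋯ +
x₀ ^ (n - 1))`. Solving this for `q u` yields the bound. -/

namespace FinMarkovChain

variable {S : Type*} [Fintype S]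

/-! ### Reachability of bottom components -/

/-- Every state has a successor. -/
theorem exists_prob_pos (M : FinMarkovChain S) (u : S) : ∃ v, 0 < M.prob u v := by
  by_contra! h
  have h1 : ∑ v, M.prob u v ≤ 0 := Finset.sum_nonpos fun v _ => h v
  rw [M.prob_sum] at h1
  linarith

/-- From every state some bottom strongly connected component can be reached. -/
theorem exists_isBSCC_reflTransGen (M : FinMarkovChain S) (v : S) :
    ∃ L, M.IsBSCC L ∧ ∃ w ∈ L, Relation.ReflTransGen (fun a b => 0 < M.prob a b) v w := by
  -- Among the states reachable from `v`, take one that reaches the fewest states. The reach set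
  -- cannot shrink further along any path, so all its members reach exactly the same states.
  obtain ⟨u, hu, hmin⟩ := Set.exists_min_image
    {u | Relation.ReflTransGen (fun a b => 0 < M.prob a b) v u}
    (fun u => {w | M.Reachable u w}.ncard) (Set.toFinite _) ⟨v, .refl⟩
  have heq : ∀ w, M.Reachable u w → {x | M.Reachable w x} = {x | M.Reachable u x} := by
    intro w hw
    refine Set.eq_of_subset_of_ncard_le (fun x hx => hw.trans hx) ?_ (Set.toFinite _)
    exact hmin w (hu.trans hw.to_reflTransGen)
  -- The minimiser `u` may itself be transient and lie outside its reach set; a successor is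
  -- certainly inside.
  obtain ⟨w, hw⟩ := M.exists_prob_pos u
  have hmutual : ∀ x, M.Reachable u x → ∀ y, M.Reachable u y → M.Reachable x y := by
    intro x hx y hy
    have : y ∈ {z | M.Reachable x z} := by rw [heq x hx]; exact hy
    exact this
  have huw : M.Reachable u w := .single hw
  refine ⟨{x | M.Reachable u x}, ⟨⟨⟨⟨w, huw⟩, hmutual⟩, ?_⟩, ?_⟩, w, huw, hu.tail hw⟩
  · intro L hL hle x hx
    exact Relation.TransGen.trans huw (hL.2 w (hle huw) x hx)
  · intro x hx y hy hxy
    exact hy (Relation.TransGen.tail hx hxy)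

/-! ### First-step analysis of reachability probabilities -/

open Classical in
/-- The probability of hitting `T` for the first time after exactly `m` steps. -/
noncomputable def firstHitProb (M : FinMarkovChain S) (T : Set S) (m : ℕ) (v : S) : ℝ≥0∞ :=
  ∑ π : Fin (m + 1) → S, if IsFirstHit v T π then ENNReal.ofReal (M.pathProb π) else 0

theorem reachProb_eq_tsum (M : FinMarkovChain S) (v : S) (T : Set S) :
    M.reachProb v T = ∑' m, M.firstHitProb T m v := rfl

open Classical in
theorem firstHitProb_zero (M : FinMarkovChain S) (T : Set S) (v : S) :
    M.firstHitProb T 0 v = if v ∈ T then 1 else 0 := by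
  unfold firstHitProb
  rw [← (Equiv.funUnique (Fin 1) S).symm.sum_comp]
  have h : ∀ s : S, IsFirstHit v T ((Equiv.funUnique (Fin 1) S).symm s) ↔ s = v ∧ s ∈ T := by
    intro s
    simp [IsFirstHit]
  simp only [h, pathProb, Finset.univ_eq_empty, Finset.prod_empty, ENNReal.ofReal_one]
  simp only [ite_and]
  simp

theorem isFirstHit_cons {S : Type*} {v s : S} {T : Set S} {m : ℕ} {π : Fin (m + 1) → S} :
    IsFirstHit v T (Fin.cons s π : Fin (m + 2) → S) ↔
      s = v ∧ v ∉ T ∧ IsFirstHit (π 0) T π := by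
  have hlast : (Fin.cons s π : Fin (m + 2) → S) (Fin.last (m + 1)) = π (Fin.last m) := by
    rw [← Fin.succ_last, Fin.cons_succ]
  unfold IsFirstHit
  rw [Fin.forall_fin_succ, hlast]
  simp only [Fin.cons_zero, Fin.castSucc_zero, ← Fin.succ_castSucc, Fin.cons_succ]
  constructor
  · rintro ⟨rfl, ⟨h1, h2⟩, h3⟩
    exact ⟨rfl, h1, trivial, h2, h3⟩
  · rintro ⟨rfl, h1, -, h2, h3⟩
    exact ⟨rfl, ⟨h1, h2⟩, h3⟩

theorem pathProb_cons (M : FinMarkovChain S) {m : ℕ} (s : S) (π : Fin (m + 1) → S) :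
    M.pathProb (Fin.cons s π : Fin (m + 2) → S) = M.prob s (π 0) * M.pathProb π := by
  unfold pathProb
  rw [Fin.prod_univ_succ]
  simp only [Fin.cons_zero, Fin.castSucc_zero, ← Fin.succ_castSucc, Fin.cons_succ]

open Classical in
theorem firstHitProb_succ (M : FinMarkovChain S) (T : Set S) (m : ℕ) (v : S) :
    M.firstHitProb T (m + 1) v =
      if v ∈ T then 0 else ∑ w, ENNReal.ofReal (M.prob v w) * M.firstHitProb T m w := by
  have hcons : M.firstHitProb T (m + 1) v = ∑ π : Fin (m + 1) → S,
      if v ∉ T ∧ IsFirstHit (π 0) T π then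
        ENNReal.ofReal (M.prob v (π 0)) * ENNReal.ofReal (M.pathProb π) else 0 := by
    unfold firstHitProb
    rw [← (Fin.consEquiv fun _ : Fin (m + 2) => S).sum_comp, Fintype.sum_prod_type]
    rw [Finset.sum_eq_single v]
    · refine Finset.sum_congr rfl fun π _ => ?_
      change (if IsFirstHit v T (Fin.cons v π : Fin (m + 2) → S) then
        ENNReal.ofReal (M.pathProb (Fin.cons v π : Fin (m + 2) → S)) else 0) = _
      simp only [isFirstHit_cons, pathProb_cons, true_and, ENNReal.ofReal_mul (M.prob_nonneg _ _)]
    · intro s _ hs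
      refine Finset.sum_eq_zero fun π _ => ?_
      exact if_neg fun h => hs (isFirstHit_cons.1 h).1
    · simp
  rw [hcons]
  split_ifs with hv
  · simp [hv]
  · unfold firstHitProb
    simp only [Finset.mul_sum, hv, not_false_eq_true, true_and]
    rw [Finset.sum_comm]
    refine Finset.sum_congr rfl fun π _ => ?_
    rw [Finset.sum_eq_single (π 0)]
    · simp
    · intro w _ hw
      rw [if_neg fun h => hw h.1.symm, mul_zero]
    · simp

theorem sum_ofReal_prob (M : FinMarkovChain S) (v : S) :
    ∑ w, ENNReal.ofReal (M.prob v w) = 1 := by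
  rw [← ENNReal.ofReal_sum_of_nonneg fun w _ => M.prob_nonneg v w, M.prob_sum,
    ENNReal.ofReal_one]

/-- Truncating at `N` steps turns the first-step recursion into an induction on `N`, for all `v` at
once, with weights that sum to 1. The resulting finiteness is what lets the recursion pass to real
numbers. -/
theorem reachProb_le_one (M : FinMarkovChain S) (v : S) (T : Set S) :
    M.reachProb v T ≤ 1 := by
  rw [reachProb_eq_tsum]
  refine ENNReal.tsum_le_of_sum_range_le fun N => ?_
  induction N generalizing v with
  | zero => simp
  | succ N ih =>
    rw [Finset.sum_range_succ']
    simp only [firstHitProb_succ, firstHitProb_zero]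
    split_ifs with hv
    · simp
    · rw [add_zero, Finset.sum_comm, ← M.sum_ofReal_prob v]
      refine Finset.sum_le_sum fun w _ => ?_
      rw [← Finset.mul_sum]
      exact mul_le_of_le_one_right' (ih w)

theorem reachProb_of_mem (M : FinMarkovChain S) {v : S} {T : Set S} (hv : v ∈ T) :
    M.reachProb v T = 1 := by
  rw [reachProb_eq_tsum, tsum_eq_zero_add' ENNReal.summable]
  simp [firstHitProb_zero, firstHitProb_succ, hv]

theorem reachProb_of_notMem (M : FinMarkovChain S) {v : S} {T : Set S} (hv : v ∉ T) :
    M.reachProb v T = ∑ w, ENNReal.ofReal (M.prob v w) * M.reachProb w T := by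
  simp only [reachProb_eq_tsum]
  rw [tsum_eq_zero_add' ENNReal.summable]
  simp only [firstHitProb_zero, firstHitProb_succ, hv, if_false, zero_add]
  rw [Summable.tsum_finsetSum fun _ _ => ENNReal.summable]
  simp only [ENNReal.tsum_mul_left]

theorem toReal_reachProb_of_notMem (M : FinMarkovChain S) {v : S} {T : Set S} (hv : v ∉ T) :
    (M.reachProb v T).toReal = ∑ w, M.prob v w * (M.reachProb w T).toReal := by
  rw [M.reachProb_of_notMem hv, ENNReal.toReal_sum]
  · simp [ENNReal.toReal_mul, ENNReal.toReal_ofReal (M.prob_nonneg _ _)]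
  · intro w _
    exact ENNReal.mul_ne_top ENNReal.ofReal_ne_top
      ((M.reachProb_le_one w T).trans_lt ENNReal.one_lt_top).ne

theorem toReal_reachProb_le_one (M : FinMarkovChain S) (v : S) (T : Set S) :
    (M.reachProb v T).toReal ≤ 1 :=
  ENNReal.toReal_le_of_le_ofReal zero_le_one (by simpa using M.reachProb_le_one v T)

/-! ### Distance layers and the geometric bound -/

/-- The states from which `B` can be reached in at most `j` steps. -/
def layer (M : FinMarkovChain S) (B : Set S) : ℕ → Set S
  | 0 => B
  | j + 1 => B ∪ {v | ∃ w ∈ layer M B j, 0 < M.prob v w}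

theorem layer_subset_succ (M : FinMarkovChain S) (B : Set S) (j : ℕ) :
    M.layer B j ⊆ M.layer B (j + 1) := by
  induction j with
  | zero => exact Set.subset_union_left
  | succ j ih =>
    rintro v (hv | ⟨w, hw, h⟩)
    · exact .inl hv
    · exact .inr ⟨w, ih hw, h⟩

/-- If `B` can be reached from everywhere, then in at most `|S|` steps. -/
theorem layer_card_eq_univ (M : FinMarkovChain S) (B : Set S)
    (hB : ∀ v, ∃ w ∈ B, Relation.ReflTransGen (fun a b => 0 < M.prob a b) v w) :
    M.layer B (Fintype.card S) = Set.univ := by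
  have key : ∀ j, M.layer B j = Set.univ ∨ j ≤ (M.layer B j).ncard := by
    intro j
    induction j with
    | zero => simp
    | succ j ih =>
      -- A layer that stops growing is closed under predecessors, hence contains everything;
      -- otherwise each step adds at least one state.
      by_cases heq : M.layer B (j + 1) ⊆ M.layer B j
      · left
        refine Set.eq_univ_of_forall fun v => M.layer_subset_succ B j ?_
        obtain ⟨w, hw, hvw⟩ := hB v
        induction hvw using Relation.ReflTransGen.head_induction_on with
        | refl =>
          cases j with
          | zero => exact hw
          | succ j => exact .inl hw
        | head hab _ ih' => exact heq (.inr ⟨_, ih', hab⟩)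
      · rcases ih with h | h
        · exact absurd (h ▸ Set.subset_univ _) heq
        · right
          have := Set.ncard_lt_ncard ⟨M.layer_subset_succ B j, heq⟩ (Set.toFinite _)
          omega
  rcases key (Fintype.card S) with h | h
  · exact h
  · refine Set.eq_of_subset_of_ncard_le (Set.subset_univ _) ?_ (Set.toFinite _)
    rwa [Set.ncard_univ, Nat.card_eq_fintype_card]

/-- Lower bound for a function that equals `1` on a set `B` reachable from everywhere and that
dominates the average over the successors, discounted by the factor `c`, outside `B`. -/
theorem geometric_bound_le (M : FinMarkovChain S) (B : Set S)
    (hB : ∀ v, ∃ w ∈ B, Relation.ReflTransGen (fun a b => 0 < M.prob a b) v w)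
    {δ c : ℝ} (hδ0 : 0 < δ) (hδ1 : δ ≤ 1) (hδ : ∀ u w, 0 < M.prob u w → δ ≤ M.prob u w)
    (hc0 : 0 ≤ c) (hc1 : c ≤ 1) (q : S → ℝ) (hq0 : ∀ v, 0 ≤ q v) (hq1 : ∀ v, q v ≤ 1)
    (hqB : ∀ v ∈ B, q v = 1) (hq : ∀ v ∉ B, c * ∑ w, M.prob v w * q w ≤ q v) (v : S) :
    (1 - δ * c) * (δ * c) ^ Fintype.card S /
      ((1 - δ * c) - (1 - (δ * c) ^ Fintype.card S) * ((1 - δ) * c)) ≤ q v := by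
  obtain ⟨u, -, hu⟩ := Set.exists_min_image Set.univ q Set.finite_univ ⟨v, trivial⟩
  replace hu : ∀ w, q u ≤ q w := fun w => hu w trivial
  set x₀ := δ * c with hx₀
  have hx0 : 0 ≤ x₀ := mul_nonneg hδ0.le hc0
  have hx1 : 0 ≤ (1 - δ) * c := mul_nonneg (by linarith) hc0
  have hx01 : x₀ ≤ 1 := mul_le_one₀ hδ1 hc0 hc1
  have hsum : x₀ + (1 - δ) * c ≤ 1 := by rw [hx₀]; linarith
  -- Closed form of the recursion `g 0 = 1`, `g (j + 1) = x₀ * g j + x₁ * q u`: the lower bound for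
  -- `q` on layer `j`.
  let g : ℕ → ℝ := fun j => x₀ ^ j + (1 - δ) * c * q u * ∑ i ∈ Finset.range j, x₀ ^ i
  have gsucc : ∀ j, g (j + 1) = x₀ * g j + (1 - δ) * c * q u := by
    intro j
    simp only [g, geom_sum_succ, pow_succ]
    ring
  have g0 : g 0 = 1 := by simp [g]
  -- Needed because `B`, where `q = 1`, is contained in every layer.
  have gle : ∀ j, g j ≤ 1 := by
    intro j
    induction j with
    | zero => exact g0.le
    | succ j ih =>
      rw [gsucc]
      have h1 := mul_le_mul_of_nonneg_left ih hx0
      have h2 := mul_le_mul_of_nonneg_left (hq1 u) hx1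
      linarith
  have step : ∀ a w, a ∉ B → 0 < M.prob a w → x₀ * q w + (1 - δ) * c * q u ≤ q a := by
    intro a w ha haw
    refine le_trans ?_ (hq a ha)
    -- After subtracting the minimum all summands are nonnegative, so all but the one for `w` can be
    -- dropped.
    have h1 : ∑ x, M.prob a x * q x = q u + ∑ x, M.prob a x * (q x - q u) := by
      simp only [mul_sub, Finset.sum_sub_distrib, ← Finset.sum_mul, M.prob_sum]
      ring
    have h2 : M.prob a w * (q w - q u) ≤ ∑ x, M.prob a x * (q x - q u) :=
      Finset.single_le_sum (f := fun x => M.prob a x * (q x - q u))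
        (fun x _ => mul_nonneg (M.prob_nonneg a x) (sub_nonneg.2 (hu x))) (Finset.mem_univ w)
    have h3 : δ * (q w - q u) ≤ M.prob a w * (q w - q u) :=
      mul_le_mul_of_nonneg_right (hδ a w haw) (sub_nonneg.2 (hu w))
    calc x₀ * q w + (1 - δ) * c * q u = c * (q u + δ * (q w - q u)) := by rw [hx₀]; ring
      _ ≤ _ := mul_le_mul_of_nonneg_left (by linarith) hc0
  have hg : ∀ j, ∀ a ∈ M.layer B j, g j ≤ q a := by
    intro j
    induction j with
    | zero => exact fun a ha => by rw [hqB a ha]; exact gle 0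
    | succ j ih =>
      intro a ha
      by_cases haB : a ∈ B
      · rw [hqB a haB]; exact gle _
      · rcases ha with ha | ⟨w, hw, haw⟩
        · exact absurd ha haB
        · refine le_trans ?_ (step a w haB haw)
          rw [gsucc]
          have := mul_le_mul_of_nonneg_left (ih w hw) hx0
          linarith
  refine le_trans ?_ (hu v)
  -- Applied to the minimiser itself, the bound becomes an inequality in `q u` alone.
  have hmin : g (Fintype.card S) ≤ q u := hg _ u (by rw [M.layer_card_eq_univ B hB]; trivial)
  have hgeom := mul_neg_geom_sum x₀ (Fintype.card S)
  simp only [g] at hmin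
  have hp0 : 0 ≤ x₀ ^ Fintype.card S := pow_nonneg hx0 _
  have hp1 : x₀ ^ Fintype.card S ≤ 1 := pow_le_one₀ hx0 hx01
  have hD : 0 ≤ (1 - x₀) - (1 - x₀ ^ Fintype.card S) * ((1 - δ) * c) := by
    have := mul_le_mul_of_nonneg_right (show 1 - x₀ ^ Fintype.card S ≤ 1 by linarith) hx1
    linarith
  -- A zero denominator is harmless here: the quotient is then 0, and `q u` is nonnegative.
  refine div_le_of_le_mul₀ hD (hq0 u) ?_
  -- Multiplying by `1 - x₀` sums the geometric series without a case split on `x₀ = 1`.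
  have h := mul_le_mul_of_nonneg_left hmin (sub_nonneg.2 hx01)
  rw [mul_add, mul_left_comm (1 - x₀) ((1 - δ) * c * q u), hgeom] at h
  linarith

end FinMarkovChain

/-! ### Transfer between the arena and its gadget -/

namespace StochasticArena

open GadgetVertex

variable {V : Type*} [Fintype V]

theorem minProb_pos [Nonempty V] (G : StochasticArena V) : 0 < G.minProb :=
  G.isLeast_minProb.1.1

theorem minProb_le_chain_prob [Nonempty V] (G : StochasticArena V) (σ : G.EveStrategy)
    (γ : G.AdamStrategy) {u w : V} (h : 0 < (G.chain σ γ).prob u w) :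
    G.minProb ≤ (G.chain σ γ).prob u w := by
  simp only [chain] at h ⊢
  split_ifs at h ⊢ with he
  · exact G.isLeast_minProb.2 ⟨h, u, w, rfl⟩
  · exact absurd h (lt_irrefl 0)

theorem minProb_le_one [Nonempty V] (G : StochasticArena V) (σ : G.EveStrategy)
    (γ : G.AdamStrategy) : G.minProb ≤ 1 := by
  obtain ⟨u⟩ := ‹Nonempty V›
  obtain ⟨w, hw⟩ := (G.chain σ γ).exists_prob_pos u
  refine (G.minProb_le_chain_prob σ γ hw).trans ?_
  rw [← (G.chain σ γ).prob_sum u]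
  exact Finset.single_le_sum (fun x _ => (G.chain σ γ).prob_nonneg u x) (Finset.mem_univ w)

theorem gadget_chain_prob_bar_hat (G : StochasticArena V) (p : V → ℕ) (α : ℕ → unitInterval)
    (σ : G.EveStrategy) (γ : G.AdamStrategy) (u w : V) :
    ((G.gadget p α).chain (σ.lift p α) (γ.lift p α)).prob (bar u) (hat w) =
      (G.chain σ γ).prob u w := by
  have h : (G.gadget p α).Enabled (σ.lift p α) (γ.lift p α) (bar u) (hat w) ↔
      G.Enabled σ γ u w := by
    simp [Enabled, gadget, gadgetKind, EveStrategy.lift, AdamStrategy.lift]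
  classical exact if_congr h rfl rfl

theorem gadget_chain_prob_hat_bar (G : StochasticArena V) (p : V → ℕ) (α : ℕ → unitInterval)
    (σ : G.EveStrategy) (γ : G.AdamStrategy) (u : V) :
    ((G.gadget p α).chain (σ.lift p α) (γ.lift p α)).prob (hat u) (bar u) =
      1 - (α (p u) : ℝ) := by
  have h : (G.gadget p α).Enabled (σ.lift p α) (γ.lift p α) (hat u) (bar u) := .inl rfl
  refine (if_pos h).trans ?_
  simp [gadget, gadgetΔ]

/-- The union of the bottom strongly connected components under `σ` and `γ`. -/
def bottom (G : StochasticArena V) (σ : G.EveStrategy) (γ : G.AdamStrategy) : Set V :=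
  ⋃₀ {U | (G.chain σ γ).IsBSCC U}

theorem sUnion_isPBSCC (G : StochasticArena V) (σ : G.EveStrategy) (γ : G.AdamStrategy) :
    ⋃₀ {P | G.IsPBSCC σ γ P} = tilde (G.bottom σ γ) := by
  ext x
  simp only [Set.mem_sUnion, Set.mem_ofPred_eq, IsPBSCC, tilde, bottom, Set.mem_union,
    Set.mem_image]
  constructor
  · rintro ⟨_, ⟨U, hU, rfl⟩, ⟨u, hu, rfl⟩ | ⟨u, hu, rfl⟩⟩
    · exact .inl ⟨u, ⟨U, hU, hu⟩, rfl⟩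
    · exact .inr ⟨u, ⟨U, hU, hu⟩, rfl⟩
  · rintro (⟨u, ⟨U, hU, hu⟩, rfl⟩ | ⟨u, ⟨U, hU, hu⟩, rfl⟩)
    · exact ⟨_, ⟨U, hU, rfl⟩, .inl ⟨u, hu, rfl⟩⟩
    · exact ⟨_, ⟨U, hU, rfl⟩, .inr ⟨u, hu, rfl⟩⟩

theorem crossPathProb_of_mem_bottom (G : StochasticArena V) (p : V → ℕ) (α : ℕ → unitInterval)
    (σ : G.EveStrategy) (γ : G.AdamStrategy) {v : V} (hv : v ∈ G.bottom σ γ) :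
    G.crossPathProb p α σ γ v = 1 := by
  refine FinMarkovChain.reachProb_of_mem _ ?_
  rw [sUnion_isPBSCC]
  exact .inl ⟨v, hv, rfl⟩

theorem discounted_average_le_crossPathProb (G : StochasticArena V) (p : V → ℕ)
    (α : ℕ → unitInterval) (hα : Antitone α) (σ : G.EveStrategy) (γ : G.AdamStrategy) {v : V}
    (hv : v ∉ G.bottom σ γ) :
    (1 - (α 0 : ℝ)) * ∑ w, (G.chain σ γ).prob v w * (G.crossPathProb p α σ γ w).toReal ≤
      (G.crossPathProb p α σ γ v).toReal := by
  simp only [crossPathProb, sUnion_isPBSCC]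
  set M := (G.gadget p α).chain (σ.lift p α) (γ.lift p α) with hM
  set T := tilde (G.bottom σ γ) with hT
  have hvT : bar v ∉ T := by simpa [hT, tilde] using hv
  have hhat : ∀ w, (1 - (α 0 : ℝ)) * (M.reachProb (bar w) T).toReal ≤
      (M.reachProb (hat w) T).toReal := by
    intro w
    have hα0 : (α (p w) : ℝ) ≤ α 0 := hα (Nat.zero_le _)
    have hα1 : 0 ≤ 1 - (α 0 : ℝ) := sub_nonneg.2 (α 0).2.2
    -- Inside `T` the first-step equation is not available, but there the reachability probability
    -- is 1.
    by_cases hw : hat w ∈ T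
    · rw [M.reachProb_of_mem hw, ENNReal.toReal_one]
      exact mul_le_one₀ (sub_le_self _ (α 0).2.1) ENNReal.toReal_nonneg
        (M.toReal_reachProb_le_one _ _)
    · rw [M.toReal_reachProb_of_notMem hw]
      refine le_trans ?_ (Finset.single_le_sum
        (f := fun x => M.prob (hat w) x * (M.reachProb x T).toReal)
        (fun x _ => mul_nonneg (M.prob_nonneg _ x) ENNReal.toReal_nonneg)
        (Finset.mem_univ (bar w)))
      simp only [hM, gadget_chain_prob_hat_bar]
      exact mul_le_mul_of_nonneg_right (by linarith) ENNReal.toReal_nonneg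
  have hnn : ∀ x, 0 ≤ M.prob (bar v) x * (M.reachProb x T).toReal := fun x =>
    mul_nonneg (M.prob_nonneg _ x) ENNReal.toReal_nonneg
  rw [M.toReal_reachProb_of_notMem hvT, GadgetVertex.sum_eq]
  have hsum : (1 - (α 0 : ℝ)) *
      ∑ w, (G.chain σ γ).prob v w * (M.reachProb (bar w) T).toReal ≤
      ∑ w, M.prob (bar v) (hat w) * (M.reachProb (hat w) T).toReal := by
    rw [Finset.mul_sum]
    refine Finset.sum_le_sum fun w _ => ?_
    rw [hM, gadget_chain_prob_bar_hat, ← hM, mul_left_comm]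
    exact mul_le_mul_of_nonneg_left (hhat w) ((G.chain σ γ).prob_nonneg v w)
  have hbar : 0 ≤ ∑ w, M.prob (bar v) (bar w) * (M.reachProb (bar w) T).toReal :=
    Finset.sum_nonneg fun w _ => hnn (bar w)
  -- Only the moves to `hat` vertices are kept; nonnegativity disposes of the other terms.
  linarith [hnn win, hnn lose]

end StochasticArena

theorem mainTheorem6 {V : Type*} [Fintype V] (G : StochasticArena V) (p : V → ℕ)
    (α : ℕ → unitInterval) (hα : Antitone α) (σ : G.EveStrategy) (γ : G.AdamStrategy) (v : V)
    (n : ℕ) (hn : n = Fintype.card V)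
    (x₀ x₁ : ℝ) (hx₀ : x₀ = G.minProb * (1 - (α 0 : ℝ)))
    (hx₁ : x₁ = (1 - G.minProb) * (1 - (α 0 : ℝ))) :
    (1 - x₀) * x₀ ^ n / ((1 - x₀) - (1 - x₀ ^ n) * x₁) ≤
      (G.crossPathProb p α σ γ v).toReal := by
  have : Nonempty V := ⟨v⟩
  subst hn hx₀ hx₁
  refine (G.chain σ γ).geometric_bound_le (G.bottom σ γ) (fun u => ?_) G.minProb_pos
    (G.minProb_le_one σ γ) (fun _ _ => G.minProb_le_chain_prob σ γ) (sub_nonneg.2 (α 0).2.2)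
    (sub_le_self _ (α 0).2.1) (fun u => (G.crossPathProb p α σ γ u).toReal)
    (fun _ => ENNReal.toReal_nonneg)
    (fun _ => FinMarkovChain.toReal_reachProb_le_one _ _ _)
    (fun u hu => by simp [G.crossPathProb_of_mem_bottom p α σ γ hu])
    (fun u hu => G.discounted_average_le_crossPathProb p α hα σ γ hu) v
  obtain ⟨L, hL, w, hw, huw⟩ := (G.chain σ γ).exists_isBSCC_reflTransGen u
  exact ⟨w, ⟨L, hL, hw⟩, huw⟩
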